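/- Let $F=(F_1,\dots,F_n):\mathbb C^n\to\mathbb C^n$ denote a polynomial map. Write $JF=(\partial F_i/\partial X_j)$ for its Jacobi matrix, $F'(X)=\det JF(X)$, and $\deg F=[\mathbb C(X_1,\dots,X_n):\mathbb C(F_1,\dots,F_n)]$ for its degree. A polynomial map $N:\mathbb C^n\to\mathbb C^n$ is called nilpotent if $(JN(X))^n=0$ as a matrix over $\mathbb C[X_1,\dots,X_n]$, and a fixed point of $N$ is a point $x\in\mathbb C^n$ with $N(x)=x$. A polynomial map $F:\mathbb C^n\to\mathbb C^n$ is stably equivalent to $G:\mathbb C^m\to\mathbb C^m$, where $n\le m$, if there are polynomial automorphisms $H,R$ of $\mathbb C^m$ (polynomial maps with polynomial inverses) such that $R\circ G=(F\times\mathrm{Id}_{\mathbb C^{m-n}})\circ H$. **Theorem.** (1) Let $F:\mathbb C^n\to\mathbb C^n$ be a polynomial map with $F'(X)\equiv 1$ and $\deg F=d$. Then there are $m\ge n$ and a nilpotent polynomial map $N:\mathbb C^m\to\mathbb C^m$ with exactly $d$ fixed points such that $F$ is stably equivalent to $\mathrm{Id}-N$. (2) Conversely, if a nilpotent polynomial map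 $N:\mathbb C^n\to\mathbb C^n$ has $d$ distinct fixed points, then $\mathrm{Id}-N$ has degree at least $d$. -/

import Mathlib

noncomputable section

/-- A morphism `ℂⁿ → ℂⁿ` of affine spaces, given by its `n` coordinate polynomials. -/
abbrev AffMor (n : ℕ) : Type := Fin n → MvPolynomial (Fin n) ℂ

namespace AffMor

/-- The identity morphism, with coordinate polynomials `X₁, …, Xₙ`. -/
def idMor (n : ℕ) : AffMor n := fun i => MvPolynomial.X i

/-- The composition `F ∘ G`, with coordinate polynomials `Fᵢ(G₁, …, Gₙ)`. -/
def comp {n : ℕ} (F G : AffMor n) : AffMor n := fun i => MvPolynomial.bind₁ G (F i)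

/-- The map `ℂⁿ → ℂⁿ` on points. -/
def toFun {n : ℕ} (F : AffMor n) (x : Fin n → ℂ) : Fin n → ℂ :=
  fun i => MvPolynomial.eval x (F i)

/-- The Jacobi matrix `JF = (∂Fᵢ/∂Xⱼ)`, with polynomial entries. -/
def jacobiMatrix {n : ℕ} (F : AffMor n) : Matrix (Fin n) (Fin n) (MvPolynomial (Fin n) ℂ) :=
  Matrix.of fun i j => MvPolynomial.pderiv j (F i)

/-- The Jacobian `F'(X) = det JF(X)`. -/
def jacobian {n : ℕ} (F : AffMor n) : MvPolynomial (Fin n) ℂ := (jacobiMatrix F).det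

/-- `N` is nilpotent if `(JN(X))ⁿ = 0`. -/
def IsNilpotentMor {n : ℕ} (N : AffMor n) : Prop := jacobiMatrix N ^ n = 0

/-- The degree of a morphism: the degree of the field extension
`ℂ(X₁, …, Xₙ) / ℂ(F₁, …, Fₙ)`. The value is `0` if the extension is infinite. -/
def degree {n : ℕ} (F : AffMor n) : ℕ :=
  Module.finrank
    (IntermediateField.adjoin ℂ
      (Set.range fun i : Fin n =>
        algebraMap (MvPolynomial (Fin n) ℂ) (FractionRing (MvPolynomial (Fin n) ℂ)) (F i)))
    (FractionRing (MvPolynomial (Fin n) ℂ))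

/-- `H` is an automorphism of `ℂⁿ`: it has an inverse that is also given by polynomials. -/
def IsAutomorphism {n : ℕ} (H : AffMor n) : Prop :=
  ∃ K : AffMor n, comp H K = idMor n ∧ comp K H = idMor n

/-- `F` and `G` are equivalent: `R ∘ G = F ∘ H` for automorphisms `H`, `R` of `ℂⁿ`. -/
def Equivalent {n : ℕ} (F G : AffMor n) : Prop :=
  ∃ H R : AffMor n, IsAutomorphism H ∧ IsAutomorphism R ∧ comp R G = comp F H

/-- `F × Id : ℂᵐ = ℂⁿ × ℂᵐ⁻ⁿ → ℂⁿ × ℂᵐ⁻ⁿ = ℂᵐ` for `n ≤ m`. -/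
def prodId {n m : ℕ} (h : n ≤ m) (F : AffMor n) : AffMor m := fun i =>
  if hi : (i : ℕ) < n then MvPolynomial.rename (Fin.castLE h) (F ⟨i, hi⟩)
  else MvPolynomial.X i

/-- `F : ℂⁿ → ℂⁿ` and `G : ℂᵐ → ℂᵐ` are stably equivalent: `n ≤ m` and `F × Id` is
equivalent to `G`. -/
def StablyEquivalent {n m : ℕ} (F : AffMor n) (G : AffMor m) : Prop :=
  ∃ h : n ≤ m, Equivalent (prodId h F) G

/-- The set of points `x ∈ ℂⁿ` with `N(x) = x`. -/
def fixedPts {n : ℕ} (N : AffMor n) : Set (Fin n → ℂ) := {x | toFun N x = x}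

end AffMor

end

/-! Counting: if the Jacobian is a unit, the inverse function theorem makes F open, so its
components are algebraically independent and ℂ(X) is finite over ℂ(F). A primitive element θ
identifies a generic fibre with the roots of a separable polynomial of degree deg F
(`exists_encard_fiber_eq_degree`). By openness, d points in any fibre spread to d points in a nearby
generic one, so no fibre has more than deg F points (`encard_fiber_le_degree`). Part (2) is the case
of the fibre of Id - N over 0, as 1 - JN is invertible.

Part (1): choose a generic value b and a preimage a. Affine changes bring F to the form Id - (P₀ + ⋯
+ Pₖ) with Pᵢ homogeneous of degree i + 2, and the zeros now correspond to the fibre over b, so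
there are deg F of them. Then `companion` spreads the Pᵢ over k + 1 blocks. Homogeneity turns a
nonzero eigenvalue of its Jacobi matrix into a rescaling of the base point, where JF is invertible,
so no such eigenvalue exists. Its fixed points are the zeros found above, and elementary operations
on the blocks give the stable equivalence. -/

noncomputable section

/-! ### Local inversion and algebraic independence -/

section

open MvPolynomial Filter Topology

theorem MvPolynomial.exists_hasStrictFDerivAt_eval {σ : Type*} [Fintype σ]
    (P : MvPolynomial σ ℂ) (x : σ → ℂ) :
    ∃ L : (σ → ℂ) →L[ℂ] ℂ, HasStrictFDerivAt (fun y => eval y P) L x ∧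
      ∀ v, L v = ∑ j, eval x (pderiv j P) * v j := by
  classical
  induction P using MvPolynomial.induction_on with
  | C a => exact ⟨0, by simpa using hasStrictFDerivAt_const a x, by simp⟩
  | add p q hp hq =>
    obtain ⟨L, hL, hL'⟩ := hp
    obtain ⟨M, hM, hM'⟩ := hq
    refine ⟨L + M, ?_, fun v => ?_⟩
    · simp only [map_add]
      exact hL.add hM
    · simp [hL', hM', add_mul, Finset.sum_add_distrib]
  | mul_X p i hp =>
    obtain ⟨L, hL, hL'⟩ := hp
    refine ⟨eval x p • ContinuousLinearMap.proj i + x i • L, ?_, fun v => ?_⟩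
    · simp only [map_mul, eval_X]
      exact hL.mul (hasStrictFDerivAt_apply i x)
    · simp [hL', pderiv_X, Pi.single_apply, Finset.sum_add_distrib, Finset.mul_sum,
        add_mul, mul_assoc, apply_ite (eval x), add_comm]

/-- A neighbourhood contains a product of balls, and a polynomial vanishing on a product of infinite
sets is zero. -/
theorem MvPolynomial.exists_eval_ne_zero_of_mem_nhds {σ : Type*} [Finite σ]
    {p : MvPolynomial σ ℂ} (hp : p ≠ 0) {y : σ → ℂ} {U : Set (σ → ℂ)} (hU : U ∈ 𝓝 y) :
    ∃ z ∈ U, eval z p ≠ 0 := by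
  have := Fintype.ofFinite σ
  by_contra! h
  obtain ⟨r, hr, hrU⟩ := Metric.mem_nhds_iff.1 hU
  refine hp (funext_set (fun i => Metric.ball (y i) r)
    (fun i => infinite_of_mem_nhds (y i) (Metric.ball_mem_nhds _ hr)) fun x hx => ?_)
  rw [← ball_pi _ hr] at hx
  simpa using h x (hrU hx)

namespace AffMor

variable {n : ℕ}

theorem ext_toFun {F G : AffMor n} (h : ∀ x, toFun F x = toFun G x) : F = G :=
  funext fun i => MvPolynomial.funext fun x => by simpa only [toFun] using congrFun (h x) i

@[simp] theorem toFun_idMor (x : Fin n → ℂ) : toFun (idMor n) x = x := by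
  ext i; simp [toFun, idMor]

theorem toFun_sub (F G : AffMor n) (x : Fin n → ℂ) :
    toFun (F - G) x = toFun F x - toFun G x := by
  ext i; simp [toFun]

theorem toFun_comp (F G : AffMor n) (x : Fin n → ℂ) :
    toFun (comp F G) x = toFun F (toFun G x) := by
  ext i
  simp only [toFun, comp, ← aeval_eq_eval, aeval_bind₁]
  rfl

/-- The value of the Jacobi matrix at a point. -/
def jacobiAt (F : AffMor n) (x : Fin n → ℂ) : Matrix (Fin n) (Fin n) ℂ :=
  (jacobiMatrix F).map (eval x)

theorem det_jacobiAt (F : AffMor n) (x : Fin n → ℂ) :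
    (jacobiAt F x).det = eval x (jacobian F) :=
  ((eval x).map_det _).symm

theorem isUnit_jacobiAt {F : AffMor n} (hF : IsUnit (jacobian F)) (x : Fin n → ℂ) :
    IsUnit (jacobiAt F x) := by
  rw [Matrix.isUnit_iff_isUnit_det, det_jacobiAt]
  exact hF.map _

theorem hasStrictFDerivAt_toFun (F : AffMor n) (x : Fin n → ℂ) :
    HasStrictFDerivAt (toFun F) (Matrix.toLin' (jacobiAt F x)).toContinuousLinearMap x := by
  rw [hasStrictFDerivAt_pi']
  intro i
  obtain ⟨L, hL, hL'⟩ := exists_hasStrictFDerivAt_eval (F i) x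
  refine hL.congr_fderiv ?_
  ext v
  simp [hL', jacobiAt, jacobiMatrix, Matrix.mulVec, dotProduct, mul_comm]

theorem map_nhds_toFun {F : AffMor n} (hF : IsUnit (jacobian F)) (x : Fin n → ℂ) :
    map (toFun F) (𝓝 x) = 𝓝 (toFun F x) := by
  obtain ⟨A, hA⟩ := isUnit_jacobiAt hF x
  let e : (Fin n → ℂ) ≃L[ℂ] (Fin n → ℂ) :=
    (Matrix.toLin'OfInv (M := A⁻¹.1) (M' := A.1) (by simp) (by simp)).toContinuousLinearEquiv
  refine HasStrictFDerivAt.map_nhds_eq_of_equiv (f' := e) ?_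
  have h := hasStrictFDerivAt_toFun F x
  rw [← hA] at h
  refine h.congr_fderiv ?_
  ext v : 1
  simp [e, Matrix.toLin'OfInv]

theorem eval_comp_toFun (F : AffMor n) (p : MvPolynomial (Fin n) ℂ) (x : Fin n → ℂ) :
    eval x (aeval F p) = eval (toFun F x) p := by
  change eval x (bind₁ F p) = _
  simp only [← aeval_eq_eval, aeval_bind₁]
  rfl

/-- A relation among the Fᵢ would vanish on the image of F, which contains a nonempty open set. -/
theorem algebraicIndependent {F : AffMor n} (hF : IsUnit (jacobian F)) :
    AlgebraicIndependent ℂ F := by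
  rw [algebraicIndependent_iff]
  intro p hp
  by_contra h0
  have hU : Set.range (toFun F) ∈ 𝓝 (toFun F 0) := by
    rw [← map_nhds_toFun hF]
    exact mem_map.2 (Filter.univ_mem' fun x => ⟨x, rfl⟩)
  obtain ⟨_, ⟨x, rfl⟩, hx⟩ := exists_eval_ne_zero_of_mem_nhds h0 hU
  exact hx (by rw [← eval_comp_toFun, hp, map_zero])

end AffMor

end

/-! ### Integral primitive elements with cleared denominators -/

section

open Polynomial

section PrimitiveElement

theorem IsFractionRing.isAlgebraic_of_finiteDimensional (A B K L : Type*) [CommRing A]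
  [IsDomain A] [CommRing B] [IsDomain B]
  [Field K] [Field L] [Algebra A B] [Algebra A K] [IsFractionRing A K] [Algebra B L]
  [IsFractionRing B L] [Algebra K L] [Algebra A L] [IsScalarTower A B L] [IsScalarTower A K L]
  [FiniteDimensional K L] :
     Algebra.IsAlgebraic A B := by
  have : Algebra.IsAlgebraic A L :=
    (IsFractionRing.comap_isAlgebraic_iff (A := A) (K := K) (C := L)).2 inferInstance
  exact Algebra.IsAlgebraic.of_injective (IsScalarTower.toAlgHom A B L)
    (IsFractionRing.injective B L)

/-- Write z = b/c. Since c is algebraic over A, it divides some nonzero r = cs from A, so rz = bs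
lies in B; a further multiple is integral. -/
theorem IsFractionRing.exists_smul_eq_algebraMap_isIntegral (A B K : Type*) {L : Type*}
  [CommRing A] [IsDomain A] [CommRing B] [IsDomain B]
  [Field K] [Field L] [Algebra A B] [Algebra A K] [IsFractionRing A K] [Algebra B L]
  [IsFractionRing B L] [Algebra K L] [Algebra A L] [IsScalarTower A B L] [IsScalarTower A K L]
  [FiniteDimensional K L] (z : L) :
    ∃ a : A, a ≠ 0 ∧ ∃ b : B, IsIntegral A b ∧ a • z = algebraMap B L b := by
  have := IsFractionRing.isAlgebraic_of_finiteDimensional A B K L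
  obtain ⟨b, c, hc, rfl⟩ := IsFractionRing.div_surjective (A := B) z
  obtain ⟨r, hr, s, hs⟩ := (Algebra.IsAlgebraic.isAlgebraic (R := A) c).exists_nonzero_dvd hc
  obtain ⟨y, hy, hint⟩ :=
    IsAlgebraic.exists_integral_multiple (Algebra.IsAlgebraic.isAlgebraic (R := A) (b * s))
  refine ⟨y * r, mul_ne_zero hy hr, y • (b * s), hint, ?_⟩
  have hc0 : algebraMap B L c ≠ 0 :=
    IsFractionRing.to_map_ne_zero_of_mem_nonZeroDivisors hc
  rw [Algebra.smul_def, Algebra.smul_def, IsScalarTower.algebraMap_apply A B L, map_mul, hs]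
  simp only [map_mul]
  field_simp

variable (A B K L : Type*) [CommRing A] [IsDomain A] [CommRing B] [IsDomain B]
  [Field K] [Field L] [Algebra A B] [Algebra A K] [IsFractionRing A K] [Algebra B L]
  [IsFractionRing B L] [Algebra K L] [Algebra A L] [IsScalarTower A B L] [IsScalarTower A K L]
  [FiniteDimensional K L]

theorem IsFractionRing.exists_isIntegral_adjoin_eq_top [Algebra.IsSeparable K L] :
    ∃ θ : B, IsIntegral A θ ∧ IntermediateField.adjoin K {algebraMap B L θ} = ⊤ := by
  obtain ⟨z, hz⟩ := Field.exists_primitive_element K L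
  obtain ⟨a, ha, θ, hθ, h⟩ := IsFractionRing.exists_smul_eq_algebraMap_isIntegral A B K z
  refine ⟨θ, hθ, ?_⟩
  rw [eq_top_iff, ← hz, IntermediateField.adjoin_le_iff, Set.singleton_subset_iff]
  have ha' : algebraMap A K a ≠ 0 := by simpa using ha
  have hz' : z = (algebraMap A K a)⁻¹ • algebraMap B L θ := by
    rw [← h, ← algebraMap_smul K a z, inv_smul_smul₀ ha']
  rw [hz']
  exact IntermediateField.smul_mem _
    (IntermediateField.mem_adjoin_simple_self K (algebraMap B L θ))

variable {A B K L} in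
theorem IsFractionRing.exists_smul_eq_aeval {θ : B}
    (hθ : IntermediateField.adjoin K {algebraMap B L θ} = ⊤) (b : B) :
    ∃ a : A, a ≠ 0 ∧ ∃ p : A[X], a • b = aeval θ p := by
  have hint : IsIntegral K (algebraMap B L θ) := Algebra.IsIntegral.isIntegral _
  have hb : algebraMap B L b ∈ Algebra.adjoin K {algebraMap B L θ} := by
    rw [← IntermediateField.adjoin_simple_toSubalgebra_of_isAlgebraic hint.isAlgebraic, hθ]
    exact IntermediateField.mem_top
  rw [Algebra.adjoin_singleton_eq_range_aeval] at hb
  obtain ⟨P, hP⟩ := hb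
  obtain ⟨c, hc0, hc⟩ := IsLocalization.integerNormalization_spec (nonZeroDivisors A) P
  refine ⟨c, nonZeroDivisors.ne_zero hc0,
    IsLocalization.integerNormalization (nonZeroDivisors A) P, ?_⟩
  apply IsFractionRing.injective B L
  have hP' : aeval (algebraMap B L θ) P = algebraMap B L b := hP
  rw [← aeval_algebraMap_apply, ← aeval_map_algebraMap K, hc, ← algebraMap_smul K c P,
    _root_.map_smul (aeval (R := K) (algebraMap B L θ)), hP',
    algebraMap_smul, Algebra.smul_def, Algebra.smul_def, map_mul,
    ← IsScalarTower.algebraMap_apply A B L]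

theorem Polynomial.exists_mul_add_mul_eq_C_of_isCoprime_map {p q : A[X]}
    (h : IsCoprime (p.map (algebraMap A K)) (q.map (algebraMap A K))) :
    ∃ a : A, a ≠ 0 ∧ ∃ u v : A[X], u * p + v * q = C a := by
  obtain ⟨U, V, h⟩ := h
  obtain ⟨c, hc0, hc⟩ := IsLocalization.integerNormalization_spec (nonZeroDivisors A) U
  obtain ⟨d, hd0, hd⟩ := IsLocalization.integerNormalization_spec (nonZeroDivisors A) V
  refine ⟨c * d, mul_ne_zero (nonZeroDivisors.ne_zero hc0) (nonZeroDivisors.ne_zero hd0),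
    C d * IsLocalization.integerNormalization (nonZeroDivisors A) U,
    C c * IsLocalization.integerNormalization (nonZeroDivisors A) V, ?_⟩
  apply Polynomial.map_injective _ (IsFractionRing.injective A K)
  have hc' : c • U = C (algebraMap A K c) * U := by
    rw [← smul_eq_C_mul, algebraMap_smul]
  have hd' : d • V = C (algebraMap A K d) * V := by
    rw [← smul_eq_C_mul, algebraMap_smul]
  simp only [Polynomial.map_add, Polynomial.map_mul, hc, hd, hc', hd', map_C, map_mul]
  linear_combination (C (algebraMap A K c) * C (algebraMap A K d)) * h

variable {B} in
-- Where q ≠ 0, B looks like A[t]/(m) with m separable: q absorbs the denominators of the xᵢ as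
-- polynomials in θ and of a Bézout identity for m and m'. Integral closedness gives m coefficients
-- in A.
theorem IsFractionRing.exists_generic_presentation [IsIntegrallyClosed A] [Algebra.IsSeparable K L]
    {ι : Type*} [Fintype ι] (x : ι → B) :
    ∃ (θ : B) (m : A[X]) (q : A), m.Monic ∧ m.natDegree = Module.finrank K L ∧ q ≠ 0 ∧
      (∀ p : A[X], aeval θ p = 0 ↔ m ∣ p) ∧ (∀ i, ∃ p : A[X], q • x i = aeval θ p) ∧
      ∃ u v : A[X], u * m + v * derivative m = C q := by
  obtain ⟨θ, hθ, htop⟩ := IsFractionRing.exists_isIntegral_adjoin_eq_top A B K L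
  have hinj : Function.Injective (algebraMap A L) := by
    rw [IsScalarTower.algebraMap_eq A K L]
    exact (algebraMap K L).injective.comp (IsFractionRing.injective A K)
  have hinjB : Function.Injective (algebraMap A B) := by
    rw [IsScalarTower.algebraMap_eq A B L] at hinj
    exact Function.Injective.of_comp hinj
  have : Module.IsTorsionFree A B := by
    rw [← faithfulSMul_iff_algebraMap_injective] at hinjB
    infer_instance
  have hmin : minpoly K (algebraMap B L θ) = (minpoly A θ).map (algebraMap A K) :=
    minpoly.isIntegrallyClosed_eq_field_fractions K L hθ
  choose a ha p hp using fun i =>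
    IsFractionRing.exists_smul_eq_aeval (A := A) (K := K) (L := L) htop (x i)
  obtain ⟨c, hc, u, v, huv⟩ := Polynomial.exists_mul_add_mul_eq_C_of_isCoprime_map A K
    (p := minpoly A θ) (q := derivative (minpoly A θ)) (by
      rw [← derivative_map, ← hmin]
      exact Algebra.IsSeparable.isSeparable K (algebraMap B L θ))
  refine ⟨θ, minpoly A θ, c * ∏ i, a i, minpoly.monic hθ, ?_,
    mul_ne_zero hc (Finset.prod_ne_zero_iff.2 fun i _ => ha i),
    fun p => (minpoly.isIntegrallyClosed_dvd_iff hθ p), fun i => ?_, ?_⟩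
  · rw [← (minpoly.monic hθ).natDegree_map (algebraMap A K), ← hmin]
    exact ((Field.primitive_element_iff_minpoly_natDegree_eq K _).1 htop)
  · obtain ⟨d, hd⟩ := Finset.dvd_prod_of_mem a (Finset.mem_univ i)
    refine ⟨C (c * d) * p i, ?_⟩
    rw [map_mul, aeval_C, ← hp, ← Algebra.smul_def, smul_smul, hd]
    exact congrArg (· • x i) (by ring)
  · refine ⟨C (∏ i, a i) * u, C (∏ i, a i) * v, ?_⟩
    rw [map_mul, ← huv]; ring

end PrimitiveElement

end

/-! ### Generic fibres have deg F points -/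

section

open MvPolynomial

/-- Here x is only a candidate point, built from a value t for θ. Rewriting G in terms of θ, up to a
power of q, is compatible with specialising to (x, t). -/
theorem MvPolynomial.exists_pow_smul_eq_aeval {k σ A : Type*} [Field k] [CommRing A] [Algebra k A]
    [Algebra A (MvPolynomial σ k)] [IsScalarTower k A (MvPolynomial σ k)] (ψ : A →ₐ[k] k)
    {θ : MvPolynomial σ k} {q : A} {p : σ → Polynomial A}
    (hp : ∀ i, q • (X i : MvPolynomial σ k) = Polynomial.aeval θ (p i)) {x : σ → k} {t : k}
    (hx : ∀ i, ψ q * x i = Polynomial.eval₂ (ψ : A →+* k) t (p i)) (G : MvPolynomial σ k) :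
    ∃ (N : ℕ) (g : Polynomial A), q ^ N • G = Polynomial.aeval θ g ∧
      ψ q ^ N * eval x G = Polynomial.eval₂ (ψ : A →+* k) t g := by
  induction G using MvPolynomial.induction_on with
  | C c =>
    refine ⟨0, Polynomial.C (algebraMap k A c), ?_, ?_⟩
    · rw [pow_zero, one_smul, Polynomial.aeval_C, ← IsScalarTower.algebraMap_apply]
      rfl
    · simp
  | add G H hG hH =>
    obtain ⟨N, g, hg, hg'⟩ := hG
    obtain ⟨M, h, hh, hh'⟩ := hH
    refine ⟨N + M, Polynomial.C (q ^ M) * g + Polynomial.C (q ^ N) * h, ?_, ?_⟩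
    · simp only [map_add, map_mul, Polynomial.aeval_C, ← hg, ← hh, ← Algebra.smul_def, smul_smul,
        smul_add, ← pow_add]
      rw [add_comm M N]
    · rw [Polynomial.eval₂_add, Polynomial.eval₂_mul, Polynomial.eval₂_mul, Polynomial.eval₂_C,
        Polynomial.eval₂_C, ← hg', ← hh', map_add, RingHom.coe_coe, map_pow, map_pow]
      ring
  | mul_X G i hG =>
    obtain ⟨N, g, hg, hg'⟩ := hG
    refine ⟨N + 1, g * p i, ?_, ?_⟩
    · rw [map_mul, ← hg, ← hp, smul_mul_smul_comm, pow_succ]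
    · rw [Polynomial.eval₂_mul, ← hg', ← hx, map_mul, eval_X]
      ring

/-- The map x ↦ θ(x) is a bijection from the fibre to the roots of the specialised m: the values
q·xᵢ are polynomials in θ, and the Bézout identity makes the roots simple. -/
theorem MvPolynomial.encard_fiber_eq_natDegree {k σ A : Type*} [Field k] [IsAlgClosed k]
    [CommRing A] [Algebra k A] [Algebra A (MvPolynomial σ k)]
    [IsScalarTower k A (MvPolynomial σ k)] (ψ : A →ₐ[k] k)
    {θ : MvPolynomial σ k} {m : Polynomial A} {q : A} (hm : m.Monic)
    (hθ : ∀ p : Polynomial A, Polynomial.aeval θ p = 0 ↔ m ∣ p)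
    (hX : ∀ i, ∃ p : Polynomial A, q • (X i : MvPolynomial σ k) = Polynomial.aeval θ p)
    (hsep : ∃ u v : Polynomial A, u * m + v * Polynomial.derivative m = Polynomial.C q)
    (hq : ψ q ≠ 0) :
    {x : σ → k | ∀ a, eval x (algebraMap A _ a) = ψ a}.encard = m.natDegree := by
  classical
  choose p hp using hX
  set S := {x : σ → k | ∀ a, eval x (algebraMap A _ a) = ψ a} with hS
  have key : ∀ x ∈ S, ∀ g : Polynomial A, eval x (Polynomial.aeval θ g) =
      Polynomial.eval₂ (ψ : A →+* k) (eval x θ) g := by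
    intro x hx g
    rw [Polynomial.aeval_def, Polynomial.hom_eval₂]
    congr 1
    ext a
    exact hx a
  have hinj : Set.InjOn (fun x => eval x θ) S := by
    intro x hx y hy (hxy : eval x θ = eval y θ)
    funext i
    apply mul_left_cancel₀ hq
    have hx' := key x hx (p i)
    have hy' := key y hy (p i)
    rw [← hp, Algebra.smul_def, map_mul, eval_X, hx] at hx'
    rw [← hp, Algebra.smul_def, map_mul, eval_X, hy] at hy'
    rw [hx', hy', hxy]
  have himage : (fun x => eval x θ) '' S = ↑(m.map (ψ : A →+* k)).roots.toFinset := by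
    ext t
    simp only [Set.mem_image, Finset.mem_coe, Multiset.mem_toFinset,
      Polynomial.mem_roots (hm.map (ψ : A →+* k)).ne_zero, Polynomial.IsRoot, Polynomial.eval_map]
    constructor
    · rintro ⟨x, hx, rfl⟩
      rw [← key x hx, (hθ m).2 dvd_rfl, map_zero]
    · intro ht
      let x : σ → k := fun i => (ψ q)⁻¹ * Polynomial.eval₂ (ψ : A →+* k) t (p i)
      have hx : ∀ i, ψ q * x i = Polynomial.eval₂ (ψ : A →+* k) t (p i) := fun i => by
        simp only [x]
        rw [mul_inv_cancel_left₀ hq]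
      -- The constant h = a will say that x lies in the fibre, and h = X that θ(x) = t. Two
      -- expressions in θ for the same element differ by a multiple of m, which vanishes at t.
      have hval : ∀ h : Polynomial A, eval x (Polynomial.aeval θ h) =
          Polynomial.eval₂ (ψ : A →+* k) t h := by
        intro h
        obtain ⟨N, g, hg, hg'⟩ := exists_pow_smul_eq_aeval ψ hp hx (Polynomial.aeval θ h)
        obtain ⟨r, hr⟩ := (hθ (Polynomial.C (q ^ N) * h - g)).1 (by
          rw [map_sub, map_mul, Polynomial.aeval_C, ← Algebra.smul_def, hg, sub_self])
        have hr' := congrArg (Polynomial.eval₂ (ψ : A →+* k) t) hr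
        rw [Polynomial.eval₂_mul, ht, zero_mul, Polynomial.eval₂_sub, Polynomial.eval₂_mul,
          Polynomial.eval₂_C, ← hg', RingHom.coe_coe, map_pow, ← mul_sub] at hr'
        exact (sub_eq_zero.1 ((mul_eq_zero_iff_left (pow_ne_zero N hq)).1 hr')).symm
      refine ⟨x, fun a => ?_, ?_⟩
      · simpa using hval (Polynomial.C a)
      · simpa using hval Polynomial.X
  rw [← hinj.encard_image, himage, Set.encard_coe_eq_coe_finsetCard, Multiset.toFinset_card_of_nodup,
    ← Polynomial.Splits.natDegree_eq_card_roots (IsAlgClosed.splits _), hm.natDegree_map]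
  apply Polynomial.nodup_roots
  obtain ⟨u, v, huv⟩ := hsep
  have h := congrArg (Polynomial.map (ψ : A →+* k)) huv
  rw [Polynomial.map_add, Polynomial.map_mul, Polynomial.map_mul, ← Polynomial.derivative_map,
    Polynomial.map_C] at h
  refine ⟨Polynomial.C (ψ q)⁻¹ * u.map ψ, Polynomial.C (ψ q)⁻¹ * v.map ψ, ?_⟩
  rw [mul_assoc, mul_assoc, ← mul_add, h, ← Polynomial.C_mul]
  simp [hq]

namespace AffMor

variable {n : ℕ}

/-- The coordinate ring of the target of `F`. It is a copy of the polynomial ring, which makes the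
coordinate ring of the source an algebra over it through the comorphism of `F`. -/
def TargetRing (_F : AffMor n) : Type := MvPolynomial (Fin n) ℂ

namespace TargetRing

variable (F : AffMor n)

instance : CommRing (TargetRing F) := inferInstanceAs (CommRing (MvPolynomial (Fin n) ℂ))
instance : IsDomain (TargetRing F) := inferInstanceAs (IsDomain (MvPolynomial (Fin n) ℂ))
instance : Algebra ℂ (TargetRing F) := inferInstanceAs (Algebra ℂ (MvPolynomial (Fin n) ℂ))
instance : IsIntegrallyClosed (TargetRing F) :=
  inferInstanceAs (IsIntegrallyClosed (MvPolynomial (Fin n) ℂ))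

/-- The comorphism of `F`. -/
def comorphism : TargetRing F →ₐ[ℂ] MvPolynomial (Fin n) ℂ :=
  (aeval F : MvPolynomial (Fin n) ℂ →ₐ[ℂ] MvPolynomial (Fin n) ℂ)

instance : Algebra (TargetRing F) (MvPolynomial (Fin n) ℂ) := (comorphism F).toRingHom.toAlgebra

instance : IsScalarTower ℂ (TargetRing F) (MvPolynomial (Fin n) ℂ) :=
  IsScalarTower.of_algebraMap_eq fun c => ((comorphism F).commutes c).symm

/-- The field `ℂ(F₁, …, Fₙ)`. -/
abbrev imageField : IntermediateField ℂ (FractionRing (MvPolynomial (Fin n) ℂ)) :=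
  IntermediateField.adjoin ℂ (Set.range fun i : Fin n =>
    algebraMap (MvPolynomial (Fin n) ℂ) (FractionRing (MvPolynomial (Fin n) ℂ)) (F i))

theorem algebraMap_comorphism_eq_aeval (p : TargetRing F) :
    algebraMap (MvPolynomial (Fin n) ℂ) (FractionRing (MvPolynomial (Fin n) ℂ)) (comorphism F p) =
      aeval (fun i => algebraMap (MvPolynomial (Fin n) ℂ)
        (FractionRing (MvPolynomial (Fin n) ℂ)) (F i)) (p : MvPolynomial (Fin n) ℂ) :=
  (aeval_algebraMap_apply (FractionRing (MvPolynomial (Fin n) ℂ)) F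
    (p : MvPolynomial (Fin n) ℂ)).symm

theorem algebraMap_comorphism_mem (p : TargetRing F) :
    algebraMap (MvPolynomial (Fin n) ℂ) (FractionRing (MvPolynomial (Fin n) ℂ)) (comorphism F p) ∈
      imageField F := by
  rw [algebraMap_comorphism_eq_aeval, IntermediateField.mem_adjoin_range_iff]
  exact ⟨p, 1, by simp⟩

instance : Algebra (TargetRing F) (imageField F) :=
  (((algebraMap (MvPolynomial (Fin n) ℂ) (FractionRing (MvPolynomial (Fin n) ℂ))).comp
    (comorphism F).toRingHom).codRestrict (imageField F) (algebraMap_comorphism_mem F)).toAlgebra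

instance : IsScalarTower (TargetRing F) (imageField F)
    (FractionRing (MvPolynomial (Fin n) ℂ)) :=
  IsScalarTower.of_algebraMap_eq fun a =>
    IsScalarTower.algebraMap_apply (TargetRing F) (MvPolynomial (Fin n) ℂ)
      (FractionRing (MvPolynomial (Fin n) ℂ)) a

variable {F}

theorem isFractionRing (hF : AlgebraicIndependent ℂ F) :
    IsFractionRing (TargetRing F) (imageField F) := by
  have hinj : Function.Injective (algebraMap (TargetRing F) (imageField F)) := by
    intro a b hab
    have h := congrArg Subtype.val hab
    exact hF (IsFractionRing.injective _ (FractionRing (MvPolynomial (Fin n) ℂ)) h)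
  have : FaithfulSMul (TargetRing F) (imageField F) :=
    (faithfulSMul_iff_algebraMap_injective _ _).2 hinj
  refine IsFractionRing.of_field _ _ fun z => ?_
  obtain ⟨r, s, h⟩ := (IntermediateField.mem_adjoin_range_iff _ _ _).1 z.2
  refine ⟨(r : TargetRing F), (s : TargetRing F), Subtype.ext ?_⟩
  rw [h]
  exact congrArg₂ (· / ·) (algebraMap_comorphism_eq_aeval F r).symm
    (algebraMap_comorphism_eq_aeval F s).symm

/-- By transcendence degree, n independent elements form a transcendence basis; a finitely generated
algebraic field extension is finite. -/
theorem finiteDimensional (hF : AlgebraicIndependent ℂ F) :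
    FiniteDimensional (imageField F) (FractionRing (MvPolynomial (Fin n) ℂ)) := by
  have hB : IsTranscendenceBasis ℂ F :=
    hF.isTranscendenceBasis_of_trdeg_le_of_finite (by rw [MvPolynomial.trdeg_of_isDomain]; simp)
  have : Algebra.IsAlgebraic (MvPolynomial (Fin n) ℂ) (FractionRing (MvPolynomial (Fin n) ℂ)) :=
    IsLocalization.isAlgebraic _ (nonZeroDivisors (MvPolynomial (Fin n) ℂ))
  have hL := hB.algebraMap_comp (A := FractionRing (MvPolynomial (Fin n) ℂ))
  have : Algebra.IsAlgebraic (imageField F) (FractionRing (MvPolynomial (Fin n) ℂ)) :=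
    hL.isAlgebraic_field
  have : Algebra.EssFiniteType (MvPolynomial (Fin n) ℂ) (FractionRing (MvPolynomial (Fin n) ℂ)) :=
    .of_isLocalization _ (nonZeroDivisors (MvPolynomial (Fin n) ℂ))
  have : Algebra.EssFiniteType ℂ (FractionRing (MvPolynomial (Fin n) ℂ)) :=
    .comp ℂ (MvPolynomial (Fin n) ℂ) _
  have := Algebra.EssFiniteType.of_comp ℂ (imageField F) (FractionRing (MvPolynomial (Fin n) ℂ))
  exact Algebra.finite_of_essFiniteType_of_isAlgebraic

end TargetRing

open TargetRing in
-- Rules out the default value of `finrank`, and later makes a generic fibre nonempty.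
theorem degree_ne_zero {F : AffMor n} (hF : IsUnit (jacobian F)) : degree F ≠ 0 := by
  have := finiteDimensional (algebraicIndependent hF)
  exact (Module.finrank_pos (R := imageField F)
    (M := FractionRing (MvPolynomial (Fin n) ℂ))).ne'

open TargetRing in
theorem exists_encard_fiber_eq_degree {F : AffMor n} (hF : IsUnit (jacobian F)) :
    ∃ q : MvPolynomial (Fin n) ℂ, q ≠ 0 ∧
      ∀ y, eval y q ≠ 0 → {x | toFun F x = y}.encard = degree F := by
  have hind := algebraicIndependent hF
  have := finiteDimensional hind
  have := isFractionRing hind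
  obtain ⟨θ, m, q, hm, hdeg, hq, hθ, hX, hsep⟩ :=
    IsFractionRing.exists_generic_presentation (TargetRing F) (imageField F)
      (FractionRing (MvPolynomial (Fin n) ℂ)) (X : Fin n → MvPolynomial (Fin n) ℂ)
  refine ⟨q, hq, fun y hy => ?_⟩
  let ψ : TargetRing F →ₐ[ℂ] ℂ := (aeval y : MvPolynomial (Fin n) ℂ →ₐ[ℂ] ℂ)
  have h := encard_fiber_eq_natDegree ψ hm hθ hX hsep hy
  rw [hdeg] at h
  refine Eq.trans (congrArg Set.encard (Set.ext fun x => ?_)) h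
  constructor
  · rintro rfl a
    exact eval_comp_toFun F a x
  · intro hx
    funext i
    have h1 := hx (X i : MvPolynomial (Fin n) ℂ)
    have h2 := eval_comp_toFun F (X i) x
    rw [eval_X] at h2
    refine (h2.symm.trans h1).trans ?_
    exact eval_X i

end AffMor

end

/-! ### Bound for all fibres and part (2) -/

section

open MvPolynomial Filter Topology

namespace AffMor

variable {n : ℕ}

/-- Separate d points of the fibre by disjoint open sets. Their images are neighbourhoods of y, so a
generic z in the intersection has a preimage in each. -/
theorem encard_fiber_le_degree {F : AffMor n} (hF : IsUnit (jacobian F)) (y : Fin n → ℂ) :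
    {x | toFun F x = y}.encard ≤ degree F := by
  refine ENat.forall_natCast_le_iff_le.1 fun d hd => ?_
  obtain ⟨s, hs, hsd⟩ := Set.exists_subset_encard_eq hd
  have hfin : s.Finite := Set.finite_of_encard_eq_coe hsd
  obtain ⟨U, hU, hdisj⟩ := hfin.t2_separation
  obtain ⟨q, hq, hcard⟩ := exists_encard_fiber_eq_degree hF
  have hV : ⋂ x ∈ s, toFun F '' U x ∈ 𝓝 y := by
    refine (biInter_mem hfin).2 fun x hx => ?_
    rw [← show toFun F x = y from hs hx, ← map_nhds_toFun hF]
    exact image_mem_map ((hU x).2.mem_nhds (hU x).1)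
  obtain ⟨z, hz, hqz⟩ := exists_eval_ne_zero_of_mem_nhds hq hV
  choose! g hgU hgz using fun x (hx : x ∈ s) => Set.mem_iInter₂.1 hz x hx
  have hinj : Set.InjOn g s := fun a ha b hb hab => by
    by_contra hne
    exact Set.disjoint_left.1 (hdisj ha hb hne) (hgU a ha) (hab ▸ hgU b hb)
  rw [← hsd, ← hinj.encard_image, ← hcard z hqz]
  exact Set.encard_le_encard (Set.image_subset_iff.2 hgz)

theorem jacobiMatrix_idMor_sub (N : AffMor n) :
    jacobiMatrix (idMor n - N) = 1 - jacobiMatrix N := by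
  ext1 i j
  simp only [jacobiMatrix, idMor, Matrix.of_apply, Pi.sub_apply, map_sub, Matrix.sub_apply,
    pderiv_X, Matrix.one_apply, Pi.single_apply]

theorem isUnit_jacobian_idMor_sub {N : AffMor n} (hN : IsNilpotentMor N) :
    IsUnit (jacobian (idMor n - N)) := by
  rw [jacobian, ← Matrix.isUnit_iff_isUnit_det, jacobiMatrix_idMor_sub]
  exact IsNilpotent.isUnit_one_sub ⟨n, hN⟩

theorem fixedPts_eq (N : AffMor n) : fixedPts N = {x | toFun (idMor n - N) x = 0} := by
  ext x
  simp [fixedPts, toFun_sub, sub_eq_zero, eq_comm]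

theorem encard_fixedPts_le_degree {N : AffMor n} (hN : IsNilpotentMor N) :
    (fixedPts N).encard ≤ degree (idMor n - N) := by
  rw [fixedPts_eq]
  exact encard_fiber_le_degree (isUnit_jacobian_idMor_sub hN) 0

end AffMor

end

/-! ### Directional derivatives, nilpotency criterion, automorphisms -/

section

open MvPolynomial

theorem MvPolynomial.IsHomogeneous.eval_smul {σ R : Type*} [Fintype σ] [CommSemiring R]
    {p : MvPolynomial σ R} {d : ℕ} (hp : p.IsHomogeneous d) (c : R) (x : σ → R) :
    eval (c • x) p = c ^ d * eval x p := by
  rw [eval_eq', eval_eq', Finset.mul_sum]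
  refine Finset.sum_congr rfl fun s hs => ?_
  rw [hp.degree_eq_sum_deg_support hs]
  simp only [Pi.smul_apply, smul_eq_mul, mul_pow, Finset.prod_mul_distrib,
    Finset.prod_pow_eq_pow_sum]
  rw [Finset.sum_subset (Finset.subset_univ s.support) fun i _ hi => Finsupp.notMem_support_iff.1 hi]
  ring

/-- Euler's identity in degree 1, where the partial derivatives are constants. -/
theorem MvPolynomial.homogeneousComponent_one {σ R : Type*} [Fintype σ] [CommRing R]
    (p : MvPolynomial σ R) :
    homogeneousComponent 1 p = ∑ i, C (eval 0 (pderiv i p)) * X i := by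
  have h1 := homogeneousComponent_isHomogeneous 1 p
  have h2 := h1.sum_X_mul_pderiv
  rw [one_smul] at h2
  rw [← h2]
  refine Finset.sum_congr rfl fun i _ => ?_
  have h0 : (pderiv i (homogeneousComponent 1 p)).IsHomogeneous 0 := h1.pderiv
  have h3 := homogeneousComponent_eq_self h0
  rw [homogeneousComponent_zero] at h3
  rw [mul_comm, ← h3, ← constantCoeff_eq, eval_zero]
  congr 2
  classical
  simp [constantCoeff_eq, coeff_pderiv, coeff_homogeneousComponent]

/-- The derivative of a polynomial at `x` in the direction `v`. -/
def MvPolynomial.dirDeriv {σ R : Type*} [Fintype σ] [CommRing R] (x v : σ → R) :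
    MvPolynomial σ R →ₗ[R] R :=
  ∑ j, v j • (aeval x).toLinearMap ∘ₗ (pderiv j).toLinearMap

theorem MvPolynomial.dirDeriv_apply {σ R : Type*} [Fintype σ] [CommRing R] (x v : σ → R)
    (p : MvPolynomial σ R) : dirDeriv x v p = ∑ j, v j * eval x (pderiv j p) := by
  simp [dirDeriv, LinearMap.sum_apply, aeval_eq_eval]

@[simp] theorem MvPolynomial.dirDeriv_X {σ R : Type*} [Fintype σ] [CommRing R] (x v : σ → R)
    (i : σ) : dirDeriv x v (X i) = v i := by
  classical
  simp [dirDeriv_apply, pderiv_X, Pi.single_apply, apply_ite (eval x)]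

theorem MvPolynomial.dirDeriv_mul_X {σ R : Type*} [Fintype σ] [CommRing R] (x v : σ → R)
    (p : MvPolynomial σ R) (i : σ) :
    dirDeriv x v (p * X i) = dirDeriv x v p * x i + eval x p * v i := by
  classical
  simp only [dirDeriv_apply, pderiv_mul, pderiv_X, Pi.single_apply, map_add, map_mul, eval_X,
    apply_ite (eval x), map_zero, mul_add, Finset.sum_add_distrib, Finset.sum_mul,
    mul_ite, mul_one, mul_zero, Finset.sum_ite_eq, Finset.mem_univ, if_true]
  exact congrArg₂ (· + ·) (Finset.sum_congr rfl fun j _ => by ring) (mul_comm _ _)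

theorem MvPolynomial.dirDeriv_rename {σ τ R : Type*} [Fintype σ] [Fintype τ] [CommRing R]
    (f : σ → τ) (x v : τ → R) (p : MvPolynomial σ R) :
    dirDeriv x v (rename f p) = dirDeriv (x ∘ f) (v ∘ f) p := by
  induction p using MvPolynomial.induction_on with
  | C a => simp [dirDeriv_apply]
  | add p q hp hq => rw [map_add, map_add, map_add, hp, hq]
  | mul_X p i hp =>
    rw [map_mul, rename_X, dirDeriv_mul_X, dirDeriv_mul_X, hp, eval_rename]
    rfl

theorem MvPolynomial.IsHomogeneous.dirDeriv_smul {σ R : Type*} [Fintype σ] [CommRing R]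
    {p : MvPolynomial σ R} {d : ℕ} (hp : p.IsHomogeneous (d + 1)) (c : R) (x v : σ → R) :
    dirDeriv (c • x) v p = c ^ d * dirDeriv x v p := by
  rw [dirDeriv_apply, dirDeriv_apply, Finset.mul_sum]
  refine Finset.sum_congr rfl fun j _ => ?_
  rw [IsHomogeneous.eval_smul (d := d) hp.pderiv]
  ring

/-- All roots of the characteristic polynomial are 0, so it is a power of X; apply Cayley–Hamilton.
-/
theorem Matrix.pow_card_eq_zero_of_eigenvalue_eq_zero {ι k : Type*} [Fintype ι] [DecidableEq ι]
    [Field k] [IsAlgClosed k] (M : Matrix ι ι k)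
    (h : ∀ (c : k) (v : ι → k), M.mulVec v = c • v → c ≠ 0 → v = 0) :
    M ^ Fintype.card ι = 0 := by
  have hroots : M.charpoly.roots = Multiset.replicate (Fintype.card ι) 0 := by
    refine Multiset.eq_replicate.2 ⟨?_, fun c hc => ?_⟩
    · rw [← Polynomial.Splits.natDegree_eq_card_roots (IsAlgClosed.splits _),
        Matrix.charpoly_natDegree_eq_dim]
    · by_contra hc0
      rw [Polynomial.mem_roots M.charpoly_monic.ne_zero, Polynomial.IsRoot, Matrix.eval_charpoly]
        at hc
      obtain ⟨v, hv, hv'⟩ := Matrix.exists_mulVec_eq_zero_iff.2 hc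
      refine hv (h c v ?_ hc0)
      rw [Matrix.sub_mulVec, sub_eq_zero] at hv'
      rw [← hv']
      simp
  have hX : M.charpoly = Polynomial.X ^ Fintype.card ι := by
    rw [(IsAlgClosed.splits M.charpoly).eq_prod_roots_of_monic M.charpoly_monic, hroots]
    simp
  have := Matrix.aeval_self_charpoly M
  rwa [hX, map_pow, Polynomial.aeval_X] at this

namespace AffMor

variable {n : ℕ}

theorem jacobiAt_mulVec (F : AffMor n) (x v : Fin n → ℂ) (i : Fin n) :
    (jacobiAt F x).mulVec v i = dirDeriv x v (F i) := by
  simp [jacobiAt, jacobiMatrix, Matrix.mulVec, dotProduct, dirDeriv_apply, mul_comm]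

/-- The chain rule, taken from uniqueness of the Fréchet derivative. -/
theorem jacobiAt_comp (F G : AffMor n) (x : Fin n → ℂ) :
    jacobiAt (comp F G) x = jacobiAt F (toFun G x) * jacobiAt G x := by
  have h := (hasStrictFDerivAt_toFun F (toFun G x)).comp x (hasStrictFDerivAt_toFun G x)
  have h' := hasStrictFDerivAt_toFun (comp F G) x
  rw [show toFun (comp F G) = toFun F ∘ toFun G from funext (toFun_comp F G)] at h'
  have e := h'.hasFDerivAt.unique h.hasFDerivAt
  apply Matrix.toLin'.injective
  rw [Matrix.toLin'_mul]
  exact LinearMap.ext fun v => congrArg (fun L => L v) e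

theorem isNilpotentMor_of_eigenvalue {N : AffMor n}
    (h : ∀ (x : Fin n → ℂ) (c : ℂ) (v : Fin n → ℂ),
      (∀ i, dirDeriv x v (N i) = c * v i) → c ≠ 0 → v = 0) : IsNilpotentMor N := by
  ext1 i j
  apply MvPolynomial.funext
  intro x
  have h0 := Matrix.pow_card_eq_zero_of_eigenvalue_eq_zero (jacobiAt N x) fun c v hv hc =>
    h x c v (fun i => by rw [← jacobiAt_mulVec, hv]; rfl) hc
  rw [Fintype.card_fin, jacobiAt] at h0
  have h1 := (map_pow (eval x).mapMatrix (jacobiMatrix N) n).trans h0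
  simpa using congrFun (congrFun h1 i) j

theorem isAutomorphism_of_toFun {H K : AffMor n} (h₁ : ∀ x, toFun H (toFun K x) = x)
    (h₂ : ∀ x, toFun K (toFun H x) = x) : IsAutomorphism H :=
  ⟨K, ext_toFun fun x => by rw [toFun_comp, h₁, toFun_idMor],
    ext_toFun fun x => by rw [toFun_comp, h₂, toFun_idMor]⟩

theorem IsAutomorphism.exists_toFun {H : AffMor n} (hH : IsAutomorphism H) :
    ∃ K : AffMor n, (∀ x, toFun H (toFun K x) = x) ∧ ∀ x, toFun K (toFun H x) = x := by
  obtain ⟨K, h₁, h₂⟩ := hH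
  exact ⟨K, fun x => by rw [← toFun_comp, h₁, toFun_idMor],
    fun x => by rw [← toFun_comp, h₂, toFun_idMor]⟩

theorem IsAutomorphism.comp {H K : AffMor n} (hH : IsAutomorphism H) (hK : IsAutomorphism K) :
    IsAutomorphism (comp H K) := by
  obtain ⟨H', h₁, h₂⟩ := hH.exists_toFun
  obtain ⟨K', k₁, k₂⟩ := hK.exists_toFun
  refine isAutomorphism_of_toFun (K := AffMor.comp K' H') (fun x => ?_) fun x => ?_
  · simp only [toFun_comp, k₁, h₁]
  · simp only [toFun_comp, k₂, h₂]

theorem toFun_prodId {m : ℕ} (h : n ≤ m) (F : AffMor n) (x : Fin m → ℂ) (i : Fin m) :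
    toFun (prodId h F) x i =
      if hi : (i : ℕ) < n then toFun F (x ∘ Fin.castLE h) ⟨i, hi⟩ else x i := by
  unfold toFun prodId
  split_ifs <;> simp [eval_rename]

theorem toFun_prodId_comp_castLE {m : ℕ} (h : n ≤ m) (F : AffMor n) (x : Fin m → ℂ) :
    toFun (prodId h F) x ∘ Fin.castLE h = toFun F (x ∘ Fin.castLE h) := by
  ext j
  simp [toFun_prodId]

theorem prodId_comp {m : ℕ} (h : n ≤ m) (F G : AffMor n) :
    prodId h (comp F G) = comp (prodId h F) (prodId h G) := by
  refine ext_toFun fun x => funext fun i => ?_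
  rw [toFun_comp, toFun_prodId, toFun_prodId, toFun_prodId_comp_castLE, toFun_comp, toFun_prodId]
  split_ifs <;> rfl

theorem prodId_idMor {m : ℕ} (h : n ≤ m) : prodId h (idMor n) = idMor m := by
  refine ext_toFun fun x => funext fun i => ?_
  rw [toFun_prodId]
  split_ifs <;> simp

theorem IsAutomorphism.prodId {m : ℕ} (h : n ≤ m) {H : AffMor n} (hH : IsAutomorphism H) :
    IsAutomorphism (prodId h H) := by
  obtain ⟨K, h₁, h₂⟩ := hH
  exact ⟨AffMor.prodId h K, by rw [← prodId_comp, h₁, prodId_idMor],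
    by rw [← prodId_comp, h₂, prodId_idMor]⟩

/-- Lets F be normalised first: A⁻¹ × Id is absorbed into R and B × Id into H. -/
theorem StablyEquivalent.of_comp {m : ℕ} {A B F : AffMor n} {G : AffMor m} (hA : IsAutomorphism A)
    (hB : IsAutomorphism B) (h : StablyEquivalent (comp A (comp F B)) G) :
    StablyEquivalent F G := by
  obtain ⟨hnm, H, R, hH, hR, e⟩ := h
  obtain ⟨A', h₁, h₂⟩ := hA
  refine ⟨hnm, AffMor.comp (AffMor.prodId hnm B) H, AffMor.comp (AffMor.prodId hnm A') R,
    (hB.prodId hnm).comp hH, (IsAutomorphism.prodId hnm ⟨A, h₂, h₁⟩).comp hR, ?_⟩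
  refine ext_toFun fun x => ?_
  have e' := congrArg (fun P => toFun (AffMor.prodId hnm A') (toFun P x)) e
  simp only [toFun_comp, prodId_comp] at e' ⊢
  rw [e', ← toFun_comp, ← prodId_comp, h₂, prodId_idMor, toFun_idMor]

/-- The affine map `x ↦ M x + c`. -/
def affine (M : Matrix (Fin n) (Fin n) ℂ) (c : Fin n → ℂ) : AffMor n :=
  fun i => ∑ j, C (M i j) * X j + C (c i)

theorem toFun_affine (M : Matrix (Fin n) (Fin n) ℂ) (c x : Fin n → ℂ) :
    toFun (affine M c) x = M.mulVec x + c := by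
  ext i; simp [toFun, affine, Matrix.mulVec, dotProduct]

theorem isAutomorphism_affine {M : Matrix (Fin n) (Fin n) ℂ} (hM : IsUnit M) (c : Fin n → ℂ) :
    IsAutomorphism (affine M c) := by
  have hdet := (Matrix.isUnit_iff_isUnit_det M).1 hM
  refine isAutomorphism_of_toFun (K := affine M⁻¹ (-(M⁻¹.mulVec c))) (fun x => ?_) fun x => ?_
  · simp [toFun_affine, Matrix.mulVec_add, Matrix.mulVec_neg, Matrix.mulVec_mulVec,
      Matrix.mul_nonsing_inv _ hdet]
  · simp [toFun_affine, Matrix.mulVec_add, Matrix.mulVec_mulVec,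
      Matrix.nonsing_inv_mul _ hdet]

theorem jacobiAt_affine (M : Matrix (Fin n) (Fin n) ℂ) (c x : Fin n → ℂ) :
    jacobiAt (affine M c) x = M := by
  ext i j
  simp [jacobiAt, jacobiMatrix, affine, pderiv_X, Pi.single_apply]

end AffMor

end

/-! ### The companion map -/

section

open MvPolynomial

namespace AffMor

variable {n k : ℕ}

/-- The `i`-th block of length `n` of a vector of length `(k + 1) * n`, zero if `k < i`. -/
def block {R : Type*} [Zero R] (x : Fin ((k + 1) * n) → R) (i : ℕ) (j : Fin n) : R :=
  if h : i < k + 1 then x (finProdFinEquiv (⟨i, h⟩, j)) else 0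

/-- The vector of length `(k + 1) * n` with given blocks. -/
def ofBlocks {R : Type*} (k : ℕ) (B : ℕ → Fin n → R) : Fin ((k + 1) * n) → R :=
  fun r => B (finProdFinEquiv.symm r).1 (finProdFinEquiv.symm r).2

theorem block_ofBlocks {R : Type*} [Zero R] (B : ℕ → Fin n → R) {i : ℕ} (hi : i < k + 1)
    (j : Fin n) : block (ofBlocks k B) i j = B i j := by
  simp [block, ofBlocks, hi]

theorem block_of_le {R : Type*} [Zero R] (x : Fin ((k + 1) * n) → R) {i : ℕ} (hi : k + 1 ≤ i)
    (j : Fin n) : block x i j = 0 := by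
  simp [block, hi.not_gt]

theorem ext_block {R : Type*} [Zero R] {x y : Fin ((k + 1) * n) → R}
    (h : ∀ i < k + 1, ∀ j, block x i j = block y i j) : x = y := by
  ext r
  obtain ⟨⟨i, j⟩, rfl⟩ := finProdFinEquiv.surjective r
  have := h i i.2 j
  rwa [block, block, dif_pos i.2, dif_pos i.2] at this

theorem eval_block (F : AffMor ((k + 1) * n)) (x : Fin ((k + 1) * n) → ℂ) (i : ℕ) (j : Fin n) :
    eval x (block F i j) = block (toFun F x) i j := by
  unfold block toFun
  split_ifs <;> simp

theorem eval_block_idMor (x : Fin ((k + 1) * n) → ℂ) (i : ℕ) (j : Fin n) :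
    eval x (block (idMor ((k + 1) * n)) i j) = block x i j := by
  rw [eval_block, toFun_idMor]

theorem dirDeriv_block_idMor (x v : Fin ((k + 1) * n) → ℂ) (i : ℕ) (j : Fin n) :
    dirDeriv x v (block (idMor ((k + 1) * n)) i j) = block v i j := by
  unfold block idMor
  split_ifs <;> simp

theorem block_sub (x y : Fin ((k + 1) * n) → ℂ) (i : ℕ) (j : Fin n) :
    block (x - y) i j = block x i j - block y i j := by
  unfold block
  split_ifs <;> simp

/-- A polynomial in `n` variables as a polynomial in the variables of the block `0`. -/
def onFirstBlock (k : ℕ) : MvPolynomial (Fin n) ℂ →ₐ[ℂ] MvPolynomial (Fin ((k + 1) * n)) ℂ :=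
  rename fun j => finProdFinEquiv (0, j)

theorem comp_eq_block_zero (x : Fin ((k + 1) * n) → ℂ) :
    (x ∘ fun j : Fin n => finProdFinEquiv ((0 : Fin (k + 1)), j)) = block x 0 := by
  ext j
  simp [block]

theorem eval_onFirstBlock (x : Fin ((k + 1) * n) → ℂ) (p : MvPolynomial (Fin n) ℂ) :
    eval x (onFirstBlock k p) = eval (block x 0) p := by
  rw [onFirstBlock, eval_rename, comp_eq_block_zero]

theorem dirDeriv_onFirstBlock (x v : Fin ((k + 1) * n) → ℂ) (p : MvPolynomial (Fin n) ℂ) :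
    dirDeriv x v (onFirstBlock k p) = dirDeriv (block x 0) (block v 0) p := by
  rw [onFirstBlock, dirDeriv_rename, comp_eq_block_zero, comp_eq_block_zero]

/-- The map `(Y₀, …, Yₖ) ↦ (P₀(Y₀) + Y₁, …, Pₖ₋₁(Y₀) + Yₖ, Pₖ(Y₀))`. -/
def companion (k : ℕ) (P : ℕ → AffMor n) : AffMor ((k + 1) * n) :=
  ofBlocks k fun i j => onFirstBlock k (P i j) + block (idMor ((k + 1) * n)) (i + 1) j

theorem block_toFun_companion (P : ℕ → AffMor n) (x : Fin ((k + 1) * n) → ℂ) {i : ℕ}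
    (hi : i < k + 1) (j : Fin n) :
    block (toFun (companion k P) x) i j = toFun (P i) (block x 0) j + block x (i + 1) j := by
  rw [← eval_block, companion, block_ofBlocks _ hi, map_add, eval_onFirstBlock, eval_block_idMor]
  rfl

/-- An eigenvector v with eigenvalue c ≠ 0 satisfies DPᵢ(x₀)v₀ + vᵢ₊₁ = c·vᵢ. Eliminating v₁, …, vₖ
leaves v₀ = Σ c⁻⁽ˡ⁺¹⁾ DPₗ(x₀)v₀, which forces v₀ = 0 and then all vᵢ = 0. -/
theorem isNilpotentMor_companion {P : ℕ → AffMor n}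
    (hP : ∀ i j, (P i j).IsHomogeneous (i + 2))
    (hF : ∀ x, IsUnit (jacobiAt (idMor n - ∑ i ∈ Finset.range (k + 1), P i) x)) :
    IsNilpotentMor (companion k P) := by
  refine isNilpotentMor_of_eigenvalue fun x c v h hc => ?_
  have hb : ∀ i < k + 1, ∀ j, dirDeriv (block x 0) (block v 0) (P i j) + block v (i + 1) j =
      c * block v i j := by
    intro i hi j
    have := h (finProdFinEquiv (⟨i, hi⟩, j))
    simp only [companion, ofBlocks, Equiv.symm_apply_apply, map_add, dirDeriv_onFirstBlock,
      dirDeriv_block_idMor] at this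
    rw [this, block, dif_pos hi]
  have hsum : ∀ i ≤ k + 1, ∀ j, block v 0 j =
      ∑ l ∈ Finset.range i, c⁻¹ ^ (l + 1) * dirDeriv (block x 0) (block v 0) (P l j) +
        c⁻¹ ^ i * block v i j := by
    intro i
    induction i with
    | zero => simp
    | succ i ih =>
      intro hi j
      have h1 := hb i hi j
      rw [ih (Nat.le_of_succ_le hi) j, Finset.sum_range_succ, add_assoc, ← mul_add]
      congr 1
      rw [pow_succ, mul_assoc, h1, inv_mul_cancel_left₀ hc]
  have hv0 : block v 0 = 0 := by
    -- DPₗ is homogeneous of degree l + 1, so c⁻⁽ˡ⁺¹⁾ DPₗ(x₀) = DPₗ(c⁻¹x₀), and v₀ lies in the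
    -- kernel of the invertible Jacobi matrix at c⁻¹x₀.
    have hinj := Matrix.mulVec_injective_of_isUnit (hF (c⁻¹ • block x 0))
    refine hinj ?_
    rw [Matrix.mulVec_zero]
    ext j
    rw [jacobiAt_mulVec, Pi.sub_apply, Finset.sum_apply, map_sub, map_sum, idMor, dirDeriv_X,
      Pi.zero_apply, sub_eq_zero]
    refine (hsum (k + 1) le_rfl j).trans ?_
    rw [block_of_le v le_rfl, mul_zero, add_zero]
    exact Finset.sum_congr rfl fun l _ => ((hP l j).dirDeriv_smul _ _ _).symm
  have hv : ∀ i < k + 1, ∀ j, block v i j = 0 := by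
    intro i
    induction i with
    | zero => exact fun _ j => congrFun hv0 j
    | succ i ih =>
      intro hi j
      have h1 := hb i (Nat.lt_of_succ_lt hi) j
      rw [ih (Nat.lt_of_succ_lt hi) j, hv0] at h1
      simpa [dirDeriv_apply] using h1
  refine ext_block fun i hi j => ?_
  rw [hv i hi]
  simp [block]

theorem toFun_sum {ι : Type*} (s : Finset ι) (P : ι → AffMor n) (x : Fin n → ℂ) (j : Fin n) :
    toFun (∑ i ∈ s, P i) x j = ∑ i ∈ s, toFun (P i) x j := by
  simp [toFun]

/-- Back substitution from the last block gives Yᵢ = Σ_{l ≥ i} Pₗ(Y₀), so a fixed point is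
determined by Y₀, subject only to the equation for i = 0. -/
theorem encard_fixedPts_companion (P : ℕ → AffMor n) :
    (fixedPts (companion k P)).encard =
      {x | toFun (idMor n - ∑ i ∈ Finset.range (k + 1), P i) x = 0}.encard := by
  have hfix : ∀ x, x ∈ fixedPts (companion k P) ↔ ∀ i < k + 1, ∀ j,
      toFun (P i) (block x 0) j + block x (i + 1) j = block x i j := by
    intro x
    constructor
    · intro hx i hi j
      rw [← block_toFun_companion P x hi, show toFun (companion k P) x = x from hx]
    · intro h
      refine ext_block fun i hi j => ?_
      rw [block_toFun_companion P x hi, h i hi]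
  have hsum : ∀ x ∈ fixedPts (companion k P), ∀ i ≤ k + 1, ∀ j,
      block x i j = ∑ l ∈ Finset.Ico i (k + 1), toFun (P l) (block x 0) j := by
    intro x hx i hi
    induction hi using Nat.decreasingInduction with
    | self => intro j; simp [block]
    | of_succ i hi ih =>
      intro j
      rw [Finset.sum_eq_sum_Ico_succ_bot hi, ← ih j, (hfix x).1 hx i hi]
  have hinj : Set.InjOn (fun x => block x 0) (fixedPts (companion k P)) := by
    intro x hx y hy (hxy : block x 0 = block y 0)
    refine ext_block fun i hi j => ?_
    rw [hsum x hx i hi.le, hsum y hy i hi.le, hxy]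
  rw [← hinj.encard_image]
  congr 1
  ext x
  simp only [Set.mem_image, Set.mem_ofPred_eq, toFun_sub, toFun_idMor, sub_eq_zero]
  constructor
  · rintro ⟨y, hy, rfl⟩
    ext j
    rw [toFun_sum, Finset.range_eq_Ico]
    exact hsum y hy 0 (Nat.zero_le _) j
  · intro hx
    have hx0 : block (ofBlocks k fun i j => ∑ l ∈ Finset.Ico i (k + 1), toFun (P l) x j) 0 = x := by
      ext j
      rw [block_ofBlocks _ k.succ_pos, ← Finset.range_eq_Ico, ← toFun_sum, ← hx]
    refine ⟨ofBlocks k fun i j => ∑ l ∈ Finset.Ico i (k + 1), toFun (P l) x j,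
      (hfix _).2 fun i hi j => ?_, hx0⟩
    rw [hx0, block_ofBlocks _ hi, Finset.sum_eq_sum_Ico_succ_bot hi]
    congr 1
    rcases Nat.lt_or_ge (i + 1) (k + 1) with h | h
    · rw [block_ofBlocks _ h]
    · rw [block_of_le _ h, Finset.Ico_eq_empty_of_le h, Finset.sum_empty]

/-- The linear map whose `i`-th block is `Yᵢ + ⋯ + Yₖ`. -/
def partialSums (n k : ℕ) : AffMor ((k + 1) * n) :=
  ofBlocks k fun i (j : Fin n) => ∑ l ∈ Finset.Ico i (k + 1), block (idMor ((k + 1) * n)) l j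

/-- The linear map whose `i`-th block is `Yᵢ - Yᵢ₊₁`. -/
def differences (n k : ℕ) : AffMor ((k + 1) * n) :=
  ofBlocks k fun i (j : Fin n) =>
    block (idMor ((k + 1) * n)) i j - block (idMor ((k + 1) * n)) (i + 1) j

/-- The map fixing `Y₀` and subtracting `Pᵢ(Y₀) + ⋯ + Pₖ(Y₀)` from `Yᵢ` for `i > 0`. -/
def shear (k : ℕ) (P : ℕ → AffMor n) : AffMor ((k + 1) * n) :=
  ofBlocks k fun i j => if i = 0 then block (idMor ((k + 1) * n)) i j else
    block (idMor ((k + 1) * n)) i j - ∑ l ∈ Finset.Ico i (k + 1), onFirstBlock k (P l j)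

theorem block_toFun_partialSums (x : Fin ((k + 1) * n) → ℂ) {i : ℕ} (hi : i ≤ k + 1) (j : Fin n) :
    block (toFun (partialSums n k) x) i j = ∑ l ∈ Finset.Ico i (k + 1), block x l j := by
  rcases hi.lt_or_eq with hi | rfl
  · rw [← eval_block, partialSums, block_ofBlocks _ hi, map_sum]
    simp only [eval_block_idMor]
  · simp [block]

theorem block_toFun_differences (x : Fin ((k + 1) * n) → ℂ) {i : ℕ} (hi : i < k + 1) (j : Fin n) :
    block (toFun (differences n k) x) i j = block x i j - block x (i + 1) j := by
  rw [← eval_block, differences, block_ofBlocks _ hi, map_sub]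
  simp only [eval_block_idMor]

theorem block_toFun_shear (P : ℕ → AffMor n) (x : Fin ((k + 1) * n) → ℂ) {i : ℕ} (hi : i < k + 1)
    (j : Fin n) :
    block (toFun (shear k P) x) i j = if i = 0 then block x i j else
      block x i j - ∑ l ∈ Finset.Ico i (k + 1), toFun (P l) (block x 0) j := by
  rw [← eval_block, shear, block_ofBlocks _ hi]
  split_ifs with h
  · rw [eval_block_idMor]
  · rw [map_sub, map_sum, eval_block_idMor]
    simp only [eval_onFirstBlock, toFun]

theorem sum_Ico_sub_succ_block (x : Fin ((k + 1) * n) → ℂ) {i : ℕ} (hi : i ≤ k + 1) (j : Fin n) :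
    ∑ l ∈ Finset.Ico i (k + 1), (block x l j - block x (l + 1) j) = block x i j := by
  induction hi using Nat.decreasingInduction with
  | self => simp [block]
  | of_succ i hi ih => rw [Finset.sum_eq_sum_Ico_succ_bot hi, ih, sub_add_cancel]

theorem isAutomorphism_partialSums : IsAutomorphism (partialSums n k) := by
  refine isAutomorphism_of_toFun (K := differences n k) (fun x => ext_block fun i hi j => ?_)
    fun x => ext_block fun i hi j => ?_
  · rw [block_toFun_partialSums _ hi.le, ← sum_Ico_sub_succ_block x hi.le j]
    exact Finset.sum_congr rfl fun l hl => block_toFun_differences x (Finset.mem_Ico.1 hl).2 j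
  · rw [block_toFun_differences _ hi, block_toFun_partialSums _ hi.le, block_toFun_partialSums _ hi,
      Finset.sum_eq_sum_Ico_succ_bot hi, add_sub_cancel_right]

/-- Y₀ is unchanged, so replacing P by -P gives the inverse. -/
theorem isAutomorphism_shear (P : ℕ → AffMor n) : IsAutomorphism (shear k P) := by
  have hinv : ∀ (P : ℕ → AffMor n) (x : Fin ((k + 1) * n) → ℂ),
      toFun (shear k P) (toFun (shear k (-P)) x) = x := by
    intro P x
    refine ext_block fun i hi j => ?_
    have h0 : block (toFun (shear k (-P)) x) 0 = block x 0 := by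
      ext j
      rw [block_toFun_shear _ _ k.succ_pos, if_pos rfl]
    rw [block_toFun_shear _ _ hi, block_toFun_shear _ _ hi, h0]
    split_ifs
    · rfl
    · simp [toFun]
  refine isAutomorphism_of_toFun (hinv P) fun x => ?_
  simpa using hinv (-P) x

theorem block_toFun_prodId (h : n ≤ (k + 1) * n) (F : AffMor n) (x : Fin ((k + 1) * n) → ℂ) {i : ℕ}
    (hi : i < k + 1) (j : Fin n) :
    block (toFun (prodId h F) x) i j = if i = 0 then toFun F (block x 0) j else block x i j := by
  have h0 : x ∘ Fin.castLE h = block x 0 := by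
    ext j
    simp only [Function.comp, block, dif_pos k.succ_pos]
    rfl
  -- Hence block 0 occupies exactly the first n coordinates, those on which `prodId` applies F.
  have hval : ((finProdFinEquiv (⟨i, hi⟩, j) : Fin ((k + 1) * n)) : ℕ) = j + n * i := rfl
  rw [block, dif_pos hi, toFun_prodId, h0]
  by_cases hi0 : i = 0
  · subst hi0
    have : ((finProdFinEquiv ((⟨0, hi⟩ : Fin (k + 1)), j) : Fin ((k + 1) * n)) : ℕ) < n := by
      rw [hval]; simp
    rw [dif_pos this, if_pos rfl]
    congr 1
  · rw [dif_neg, if_neg hi0, block, dif_pos hi]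
    rw [hval, not_lt]
    exact le_add_left (Nat.le_mul_of_pos_right n (Nat.pos_of_ne_zero hi0))

/-- Summing the blocks of Id - N from i on telescopes the shifts and leaves Yᵢ - Σ_{l ≥ i} Pₗ(Y₀):
the original map for i = 0, the shear for i > 0. -/
theorem stablyEquivalent_companion (P : ℕ → AffMor n) :
    StablyEquivalent (idMor n - ∑ i ∈ Finset.range (k + 1), P i)
      (idMor ((k + 1) * n) - companion k P) := by
  have hn : n ≤ (k + 1) * n := Nat.le_mul_of_pos_left n k.succ_pos
  refine ⟨hn, shear k P, partialSums n k, isAutomorphism_shear P, isAutomorphism_partialSums,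
    ext_toFun fun x => ext_block fun i hi j => ?_⟩
  have hS : block (toFun (partialSums n k) (toFun (idMor ((k + 1) * n) - companion k P) x)) i j =
      block x i j - ∑ l ∈ Finset.Ico i (k + 1), toFun (P l) (block x 0) j := by
    rw [block_toFun_partialSums _ hi.le, ← sum_Ico_sub_succ_block x hi.le j,
      ← Finset.sum_sub_distrib]
    refine Finset.sum_congr rfl fun l hl => ?_
    rw [toFun_sub, toFun_idMor, block_sub, block_toFun_companion P x (Finset.mem_Ico.1 hl).2]
    ring
  rw [toFun_comp, toFun_comp, hS, block_toFun_prodId hn _ _ hi, block_toFun_shear P x hi]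
  split_ifs with hi0
  · subst hi0
    have h0 : block (toFun (shear k P) x) 0 = block x 0 := by
      ext j
      rw [block_toFun_shear _ _ hi, if_pos rfl]
    rw [h0, toFun_sub, toFun_idMor, Pi.sub_apply, toFun_sum, Finset.range_eq_Ico]
  · rfl

end AffMor

end

/-! ### Normalisation at a generic point and part (1) -/

section

open MvPolynomial

namespace AffMor

variable {n : ℕ}

theorem exists_eq_idMor_sub_sum {F : AffMor n} (h0 : toFun F 0 = 0) (h1 : jacobiAt F 0 = 1) :
    ∃ (k : ℕ) (P : ℕ → AffMor n), (∀ i j, (P i j).IsHomogeneous (i + 2)) ∧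
      F = idMor n - ∑ i ∈ Finset.range (k + 1), P i := by
  obtain ⟨k, hk⟩ : ∃ k, ∀ j, (F j).totalDegree ≤ k :=
    ⟨Finset.univ.sup fun j => (F j).totalDegree, fun j =>
      Finset.le_sup (f := fun j => (F j).totalDegree) (Finset.mem_univ j)⟩
  refine ⟨k, fun i j => -homogeneousComponent (i + 2) (F j),
    fun i j => (homogeneousComponent_isHomogeneous _ _).neg, ?_⟩
  ext1 j
  -- Degrees 0 and 1 are split off below, which leaves k + 1 components of degree i + 2.
  have hsum : ∑ i ∈ Finset.range (k + 3), homogeneousComponent i (F j) = F j := by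
    rw [← Finset.sum_subset (Finset.range_subset_range.2
      (show (F j).totalDegree + 1 ≤ k + 3 by have := hk j; omega)), sum_homogeneousComponent]
    intro i _ hi
    exact homogeneousComponent_eq_zero _ _ (by simpa using hi)
  have hc0 : homogeneousComponent 0 (F j) = 0 := by
    have := congrFun h0 j
    rw [homogeneousComponent_zero, ← constantCoeff_eq, ← eval_zero]
    simpa [toFun] using this
  have hc1 : homogeneousComponent 1 (F j) = X j := by
    have : ∀ i, eval 0 (pderiv i (F j)) = (1 : Matrix (Fin n) (Fin n) ℂ) j i := fun i => by
      rw [← h1]; rfl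
    rw [homogeneousComponent_one]
    simp only [this, Matrix.one_apply]
    simp
  rw [Finset.sum_range_succ', Finset.sum_range_succ', hc0, hc1, add_zero] at hsum
  rw [Pi.sub_apply, Finset.sum_apply, Finset.sum_neg_distrib, sub_neg_eq_add, add_comm]
  exact hsum.symm

theorem exists_isNilpotentMor_stablyEquivalent {F : AffMor n} (hF : IsUnit (jacobian F)) :
    ∃ (m : ℕ) (N : AffMor m), IsNilpotentMor N ∧ StablyEquivalent F (idMor m - N) ∧
      (fixedPts N).encard = degree F := by
  obtain ⟨q, hq, hcard⟩ := exists_encard_fiber_eq_degree hF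
  -- The value must be generic: an arbitrary fibre may have fewer than deg F points.
  obtain ⟨b, -, hb⟩ := exists_eval_ne_zero_of_mem_nhds hq (Filter.univ_mem (f := nhds 0))
  have hfib := hcard b hb
  obtain ⟨a, ha⟩ : {x | toFun F x = b}.Nonempty := by
    rw [← Set.encard_ne_zero, hfib]
    exact_mod_cast degree_ne_zero hF
  set L := jacobiAt F a with hL
  have hLu : IsUnit L := isUnit_jacobiAt hF a
  have hLi : IsUnit L⁻¹ := (Matrix.isUnit_nonsing_inv_iff).2 hLu
  have hdet := (Matrix.isUnit_iff_isUnit_det L).1 hLu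
  let T := affine (1 : Matrix (Fin n) (Fin n) ℂ) a
  let A := affine L⁻¹ (-(L⁻¹.mulVec b))
  have hT : ∀ x, toFun T x = x + a := fun x => by simp [T, toFun_affine]
  have hA : ∀ y, toFun A y = L⁻¹.mulVec (y - b) := fun y => by
    rw [toFun_affine, Matrix.mulVec_sub, sub_eq_add_neg]
  -- G(x) = L⁻¹(F(x + a) - b) fixes 0, has Jacobi matrix 1 there, and its zeros are the fibre over b
  -- translated by -a.
  let G := comp A (comp F T)
  have hG : ∀ x, toFun G x = L⁻¹.mulVec (toFun F (x + a) - b) := fun x => by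
    simp only [G, toFun_comp, hA, hT]
  have hJ : ∀ x, jacobiAt G x = L⁻¹ * jacobiAt F (x + a) := fun x => by
    simp only [G, A, T, jacobiAt_comp, jacobiAt_affine, mul_one]
    rw [← hT]
  obtain ⟨k, P, hP, hGP⟩ := exists_eq_idMor_sub_sum (F := G)
    (by rw [hG, zero_add, show toFun F a = b from ha, sub_self, Matrix.mulVec_zero])
    (by rw [hJ, zero_add, Matrix.nonsing_inv_mul _ hdet])
  refine ⟨(k + 1) * n, companion k P, isNilpotentMor_companion hP fun x => ?_, ?_, ?_⟩
  · rw [← hGP, hJ]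
    exact hLi.mul (isUnit_jacobiAt hF _)
  · refine StablyEquivalent.of_comp (A := A) (B := T) (isAutomorphism_affine hLi _)
      (isAutomorphism_affine isUnit_one _) ?_
    have := stablyEquivalent_companion (k := k) P
    rwa [← hGP] at this
  · rw [encard_fixedPts_companion, ← hGP, ← hfib,
      ← (add_left_injective a).encard_image {x | toFun G x = 0}]
    congr 1
    ext y
    simp only [Set.mem_image, Set.mem_ofPred_eq, hG]
    constructor
    · rintro ⟨x, hx, rfl⟩
      refine sub_eq_zero.1 (Matrix.mulVec_injective_of_isUnit hLi ?_)
      rw [hx, Matrix.mulVec_zero]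
    · intro hy
      exact ⟨y - a, by rw [sub_add_cancel, hy, sub_self, Matrix.mulVec_zero], sub_add_cancel y a⟩

end AffMor

end

end

theorem mainTheorem2 :
    (∀ (n d : ℕ) (F : AffMor n), AffMor.jacobian F = 1 → AffMor.degree F = d →
      ∃ (m : ℕ) (N : AffMor m), AffMor.IsNilpotentMor N ∧
        AffMor.StablyEquivalent F (AffMor.idMor m - N) ∧
        (AffMor.fixedPts N).encard = (d : ℕ∞)) ∧
    (∀ (n d : ℕ) (N : AffMor n), AffMor.IsNilpotentMor N →
      (d : ℕ∞) ≤ (AffMor.fixedPts N).encard →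
        d ≤ AffMor.degree (AffMor.idMor n - N)) := by
  refine ⟨fun n d F hF hd => ?_, fun n d N hN hd => ?_⟩
  · rw [← hd]
    exact AffMor.exists_isNilpotentMor_stablyEquivalent (hF ▸ isUnit_one)
  · exact_mod_cast hd.trans (AffMor.encard_fixedPts_le_degree hN)
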